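/- Let $d\in\mathbb N$, $d\ge 1$, $\alpha\in(0,2)$, $\beta\in(0,\infty)$, $\gamma\in[0,\infty)$, and fix a real number $\ell$ with $\max\left(-1,-\frac{\gamma}{\beta}-\frac{d}{2\beta}\right)<\ell<0$. For $\sigma\in\mathbb R$ put $$\mathcal H_{\sigma,\gamma}(z)=\frac{\Gamma(\frac d2+\gamma+\beta z)\,\Gamma(1+z)\,\Gamma(-z)}{\Gamma(-\gamma-\beta z)\,\Gamma(1-\sigma+\alpha z)},\qquad \mathbb H_{\sigma,\gamma}(r)=\frac1{2\pi i}\int_{\ell-i\infty}^{\ell+i\infty}\mathcal H_{\sigma,\gamma}(z)\,r^{-z}\,dz\quad(r>0),$$ where $1/\Gamma$ is $0$ at the poles of $\Gamma$, and for $t>0$, $x\in\mathbb R^d\setminus\{0\}$ $$p_{\sigma,\gamma}(t,x)=\frac{2^{2\gamma}}{\pi^{d/2}}|x|^{-d-2\gamma}t^{-\sigma}\,\mathbb H_{\sigma,\gamma}\!\left(\frac{|x|^{2\beta}}{2^{2\beta}}t^{-\alpha}\right).$$ For $a>0$ let $I_t^a u(t)=\frac1{\Gamma(a)}\int_0^t(t-s)^{a-1}u(s)\,ds$,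 and for $a\ge0$ let $D_t^a u=\left(\frac{d}{dt}\right)^n I_t^{n-a}u$ with $n\in\mathbb N$, $n-1\le a<n$. Let $\mathbb D_t^\sigma=D_t^\sigma$ for $\sigma\ge0$ and $\mathbb D_t^\sigma=I_t^{|\sigma|}$ for $\sigma<0$. Then the integrals defining $\mathbb H_{\sigma,\gamma}$ converge absolutely for every $\sigma\in\mathbb R$, and the following hold for every $x\in\mathbb R^d\setminus\{0\}$. 1. For all $\sigma\in\mathbb R$ and $m\in\mathbb N$, the function $t\mapsto p_{\sigma,\gamma}(t,x)$ is $m$ times continuously differentiable on $(0,\infty)$, and $$\left(\frac{\partial}{\partial t}\right)^m p_{\sigma,\gamma}(t,x)=p_{\sigma+m,\gamma}(t,x),\qquad t>0.$$ 2. For all $\eta\in(-\infty,1)$ and $\sigma\in\mathbb R$, the operator $\mathbb D_t^\sigma$ can be applied to $p_{\eta,\gamma}(\cdot,x)$: this function is integrable on $(0,T)$ for every $T>0$, the integral in the definition of $\mathbb D_t^\sigma$ converges absolutely for every $t>0$, and, if $\sigma\ge0$ and $n-1\le\sigma<n$, then $I_t^{n-\sigma}p_{\eta,\gamma}(\cdot,x)$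 is $n$ times continuously differentiable on $(0,\infty)$. Moreover $$\mathbb D_t^\sigma p_{\eta,\gamma}(t,x)=p_{\sigma+\eta,\gamma}(t,x),\qquad t>0.$$ -/

import Mathlib

noncomputable section

/-- The Mellin--Barnes integrand (without the power of `r`)
`Γ(d/2+γ+βz) Γ(1+z) Γ(-z) / (Γ(-γ-βz) Γ(1-σ+αz))`.
Mathlib puts `Γ = 0` at the poles, so the reciprocal Gamma factors of the denominator have their
correct value `0` there; the factors of the numerator have no pole with
`max (-1) (-γ/β - d/(2β)) < Re z < 0`. -/
def barnesKernel (d : ℕ) (α β σ γ : ℝ) (z : ℂ) : ℂ :=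
  (Complex.Gamma ((d : ℂ) / 2 + γ + β * z) * Complex.Gamma (1 + z) * Complex.Gamma (-z)) /
    (Complex.Gamma (-γ - β * z) * Complex.Gamma (1 - σ + α * z))

/-- The Fox H function attached to `barnesKernel`, as the Mellin--Barnes integral
`(2πi)⁻¹ ∫ 𝓗(z) r^(-z) dz` over the vertical line `Re z = ℓ`, oriented upwards:
with `z = ℓ + i y` this is Mathlib's `mellinInv`. -/
def foxH (d : ℕ) (α β γ ℓ σ r : ℝ) : ℂ :=
  mellinInv ℓ (barnesKernel d α β σ γ) r

/-- The kernel `p_{σ,γ}(t,x)` for `t > 0` and `x ≠ 0` (with `ℓ` the abscissa of the contour). -/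
def kernelP (d : ℕ) (α β γ ℓ σ t : ℝ) (x : EuclideanSpace ℝ (Fin d)) : ℂ :=
  ((2 ^ (2 * γ) / Real.pi ^ ((d : ℝ) / 2) * ‖x‖ ^ (-(d : ℝ) - 2 * γ) * t ^ (-σ) : ℝ) : ℂ) *
    foxH d α β γ ℓ σ (‖x‖ ^ (2 * β) / 2 ^ (2 * β) * t ^ (-α))

/-- Riemann--Liouville fractional integral of order `a > 0`, based at `0`. -/
def rlIntegral (a : ℝ) (u : ℝ → ℂ) (t : ℝ) : ℂ :=
  (1 / Real.Gamma a) • ∫ s in (0 : ℝ)..t, (t - s) ^ (a - 1) • u s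

/-- Riemann--Liouville fractional derivative of order `a ≥ 0`:
`(d/dt)^n I^(n-a) u` with `n - 1 ≤ a < n`, that is `n = ⌊a⌋ + 1`. -/
def rlDeriv (a : ℝ) (u : ℝ → ℂ) (t : ℝ) : ℂ :=
  iteratedDeriv (⌊a⌋₊ + 1) (rlIntegral ((⌊a⌋₊ + 1 : ℕ) - a) u) t

/-- The Riemann--Liouville operator of real order `σ`: the integral of order `|σ|` for `σ < 0`,
the derivative of order `σ` for `σ ≥ 0` (the order `0` is `(d/dt) I^1`). -/
def rlOp (σ : ℝ) (u : ℝ → ℂ) (t : ℝ) : ℂ :=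
  if σ < 0 then rlIntegral (-σ) u t else rlDeriv σ u t

/-- The integral of order `a` of `u` makes sense at every `t > 0`. -/
def RLIntegralDefined (a : ℝ) (u : ℝ → ℂ) : Prop :=
  ∀ t : ℝ, 0 < t →
    IntervalIntegrable (fun s : ℝ => (t - s) ^ (a - 1) • u s) MeasureTheory.volume 0 t

/-- The operator of order `σ` can be applied to `u` in the classical sense on `(0,∞)`:
`u` is integrable on every `(0,T)`, the integral that occurs converges absolutely at every `t > 0`,
and, for `σ ≥ 0`, it can be differentiated as often as required, continuously. -/
def RLOpDefined (σ : ℝ) (u : ℝ → ℂ) : Prop :=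
  (∀ T : ℝ, 0 < T → MeasureTheory.IntegrableOn u (Set.Ioo 0 T)) ∧
  (σ < 0 → RLIntegralDefined (-σ) u) ∧
  (0 ≤ σ → RLIntegralDefined ((⌊σ⌋₊ + 1 : ℕ) - σ) u ∧
    ContDiffOn ℝ ((⌊σ⌋₊ + 1 : ℕ) : WithTop ℕ∞)
      (rlIntegral ((⌊σ⌋₊ + 1 : ℕ) - σ) u) (Set.Ioi 0))

end

/-! With ρ = (|x|/2)^(2β), the kernel is, up to a constant, the superposition over the line Re z = ℓ
of the powers t^w, w = αz - σ, with weight ρ^(-z) 𝓗(z). Differentiation multiplies t^w by w and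
lowers the exponent by 1; the integral of order a multiplies t^w by Γ(w+1)/Γ(w+1+a) and raises the
exponent by a. By the functional equation and the Beta identity these multipliers turn 1/Γ(1-σ+αz)
into the same factor with σ+1, respectively σ-a, in place of σ (`barnesExponent_mul_barnesDensity`,
`betaIntegral_mul_barnesDensity`).

The interchanges rest on exponential decay of 𝓗. The two factors in ±βz contribute type 0,
Γ(1+z)Γ(-z) contributes -π and 1/Γ(1-σ+αz) contributes πα/2; the sum is negative because α < 2
(`exists_barnesKernel_decay`). These types come from Beta integrals and reflection, without
Stirling's formula.

Fubini for the integral of p_η needs Re w > -1, that is αℓ > η-1. When ℓ violates this, the contour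
is moved towards 0, which is possible since η < 1 and crosses no pole (`foxH_eq`). A derivative of
order σ is then n differentiations after an integral of order n-σ. -/

/-! ### Exponential type on vertical strips. -/

/-- `f` has exponential type at most `k` in the imaginary direction, uniformly on the closed
vertical strip `a ≤ Re z ≤ b`. -/
def HasExpTypeOnStrip (a b k : ℝ) (f : ℂ → ℂ) : Prop :=
  ∀ ε : ℝ, 0 < ε → ∃ C : ℝ, ∀ z : ℂ, z.re ∈ Set.Icc a b →
    ‖f z‖ ≤ C * Real.exp ((k + ε) * |z.im|)

lemma HasExpTypeOnStrip.mul {a b k l : ℝ} {f g : ℂ → ℂ} (hf : HasExpTypeOnStrip a b k f)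
    (hg : HasExpTypeOnStrip a b l g) : HasExpTypeOnStrip a b (k + l) (fun z => f z * g z) := by
  intro ε hε
  obtain ⟨C, hC⟩ := hf (ε / 2) (by positivity)
  obtain ⟨D, hD⟩ := hg (ε / 2) (by positivity)
  refine ⟨C * D, fun z hz => ?_⟩
  rw [norm_mul]
  calc ‖f z‖ * ‖g z‖
      ≤ (C * Real.exp ((k + ε / 2) * |z.im|)) * (D * Real.exp ((l + ε / 2) * |z.im|)) :=
        mul_le_mul (hC z hz) (hD z hz) (norm_nonneg _) ((norm_nonneg _).trans (hC z hz))
    _ = C * D * Real.exp ((k + l + ε) * |z.im|) := by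
        rw [mul_mul_mul_comm, ← Real.exp_add]
        ring_nf

lemma HasExpTypeOnStrip.of_norm_le {a b k : ℝ} {f g : ℂ → ℂ} (hg : HasExpTypeOnStrip a b k g)
    (C : ℝ) (hC : 0 ≤ C) (h : ∀ z : ℂ, z.re ∈ Set.Icc a b → ‖f z‖ ≤ C * ‖g z‖) :
    HasExpTypeOnStrip a b k f := by
  intro ε hε
  obtain ⟨D, hD⟩ := hg ε hε
  refine ⟨C * D, fun z hz => (h z hz).trans ?_⟩
  rw [mul_assoc]
  exact mul_le_mul_of_nonneg_left (hD z hz) hC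

lemma affine_pow_le_exp (A B ε : ℝ) (hA : 0 ≤ A) (hB : 0 ≤ B) (hε : 0 < ε) (N : ℕ) :
    ∃ C : ℝ, ∀ y : ℝ, 0 ≤ y → (A + B * y) ^ N ≤ C * Real.exp (ε * y) := by
  have hN : (0 : ℝ) < N + 1 := by positivity
  -- Dividing by N+1 instead of N covers N = 0; only Nδ ≤ ε is needed.
  set δ := ε / (N + 1) with hδ
  have hδ0 : 0 < δ := by positivity
  refine ⟨(A + B / δ) ^ N, fun y hy => ?_⟩
  have h1 : A + B * y ≤ (A + B / δ) * Real.exp (δ * y) := by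
    have h2 : δ * y + 1 ≤ Real.exp (δ * y) := Real.add_one_le_exp _
    have h3 : A + B * y ≤ (A + B / δ) * (δ * y + 1) := by
      have : B / δ * (δ * y) = B * y := by field_simp
      have h4 : 0 ≤ A * (δ * y) := by positivity
      have h5 : 0 ≤ B / δ := by positivity
      nlinarith
    exact h3.trans (mul_le_mul_of_nonneg_left h2 (by positivity))
  calc (A + B * y) ^ N ≤ ((A + B / δ) * Real.exp (δ * y)) ^ N :=
        pow_le_pow_left₀ (by positivity) h1 N
    _ = (A + B / δ) ^ N * Real.exp (N * (δ * y)) := by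
        rw [mul_pow, ← Real.exp_nat_mul]
    _ ≤ (A + B / δ) ^ N * Real.exp (ε * y) := by
        apply mul_le_mul_of_nonneg_left _ (by positivity)
        apply Real.exp_le_exp.2
        have : (N : ℝ) * δ ≤ ε := by
          rw [hδ, mul_div_assoc', div_le_iff₀ hN]; nlinarith
        nlinarith

lemma hasExpTypeOnStrip_affine_pow (a b c β : ℝ) (hc : 0 ≤ c) (hβ : 0 ≤ β) (N : ℕ) :
    HasExpTypeOnStrip a b 0 (fun z => (((c + β * ‖z‖) ^ N : ℝ) : ℂ)) := by
  intro ε hε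
  obtain ⟨C, hC⟩ := affine_pow_le_exp (c + β * (|a| + |b|)) β ε (by positivity) hβ hε N
  refine ⟨C, fun z hz => ?_⟩
  rw [Complex.norm_real, Real.norm_of_nonneg (by positivity), zero_add]
  refine le_trans (pow_le_pow_left₀ (by positivity) ?_ N) (hC |z.im| (abs_nonneg _))
  have h1 := Complex.norm_le_abs_re_add_abs_im z
  have h2 : |z.re| ≤ |a| + |b| := by
    obtain ⟨h3, h4⟩ := hz
    rw [abs_le]
    constructor
    · linarith [neg_abs_le a, abs_nonneg b]
    · linarith [le_abs_self b, abs_nonneg a]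
  nlinarith

/-! ### Growth of Gamma factors along vertical lines. -/

/-- The quotient Γ(w)/Γ(w+s) is B(w,s)/Γ(s), and |x^(w-1)| = x^(Re w - 1) under the Beta integral.
Thus two Gamma values with equal imaginary parts are compared by a bound depending on real parts
only. -/
lemma Complex.norm_Gamma_mul_norm_inv_Gamma_add_le (w : ℂ) (s : ℝ) (hw : 0 < w.re) (hs : 0 < s) :
    ‖Complex.Gamma w‖ * ‖(Complex.Gamma (w + s))⁻¹‖ ≤
      ‖Complex.Gamma (w.re : ℂ)‖ * ‖(Complex.Gamma ((w.re : ℂ) + s))⁻¹‖ := by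
  have hb : ‖Complex.betaIntegral w s‖ ≤ ‖Complex.betaIntegral w.re s‖ := by
    have key : Complex.betaIntegral w.re s
        = ((∫ x in (0 : ℝ)..1, x ^ (w.re - 1) * (1 - x) ^ (s - 1) : ℝ) : ℂ) := by
      rw [Complex.betaIntegral, ← intervalIntegral.integral_ofReal]
      apply intervalIntegral.integral_congr
      intro x hx
      rw [Set.uIcc_of_le zero_le_one] at hx
      simp only
      rw [Complex.ofReal_mul, Complex.ofReal_cpow hx.1, Complex.ofReal_cpow (by linarith [hx.2])]
      push_cast
      rfl
    rw [key, Complex.norm_real, Real.norm_eq_abs]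
    refine le_trans ?_ (le_abs_self _)
    rw [Complex.betaIntegral]
    refine (intervalIntegral.norm_integral_le_integral_norm zero_le_one).trans (le_of_eq ?_)
    rw [intervalIntegral.integral_of_le zero_le_one, intervalIntegral.integral_of_le zero_le_one,
      MeasureTheory.integral_Ioc_eq_integral_Ioo, MeasureTheory.integral_Ioc_eq_integral_Ioo]
    refine MeasureTheory.setIntegral_congr_fun measurableSet_Ioo fun x hx => ?_
    rw [norm_mul, Complex.norm_cpow_eq_rpow_re_of_pos hx.1]
    have : (1 - (x : ℂ)) = ((1 - x : ℝ) : ℂ) := by push_cast; rfl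
    rw [this, Complex.norm_cpow_eq_rpow_re_of_pos (by linarith [hx.2])]
    simp
  have h1 := Complex.Gamma_mul_Gamma_eq_betaIntegral (s := w) (t := s) hw (by simpa using hs)
  have h2 := Complex.Gamma_mul_Gamma_eq_betaIntegral (s := (w.re : ℂ)) (t := s) (by simpa using hw)
    (by simpa using hs)
  have hG0 : Complex.Gamma s ≠ 0 := Complex.Gamma_ne_zero_of_re_pos (by simpa using hs)
  have hG1 : Complex.Gamma (w + s) ≠ 0 :=
    Complex.Gamma_ne_zero_of_re_pos (by simpa using add_pos hw hs)
  have hG2 : Complex.Gamma ((w.re : ℂ) + s) ≠ 0 :=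
    Complex.Gamma_ne_zero_of_re_pos (by simpa using add_pos hw hs)
  have e1 : Complex.Gamma w * (Complex.Gamma (w + s))⁻¹
      = Complex.betaIntegral w s / Complex.Gamma s := by
    field_simp; rw [h1]
  have e2 : Complex.Gamma (w.re : ℂ) * (Complex.Gamma ((w.re : ℂ) + s))⁻¹
      = Complex.betaIntegral w.re s / Complex.Gamma s := by
    field_simp; rw [h2]
  rw [← norm_mul, ← norm_mul, e1, e2, norm_div, norm_div]
  gcongr

/-- Iterating 1/Γ(w) = w/Γ(w+1) moves the argument to the right, at polynomial cost, which does not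
affect the exponential type. -/
lemma Complex.norm_inv_Gamma_le_shift (N : ℕ) (w : ℂ) :
    ‖(Complex.Gamma w)⁻¹‖ ≤ (‖w‖ + N) ^ N * ‖(Complex.Gamma (w + N))⁻¹‖ := by
  induction N generalizing w with
  | zero => simp
  | succ N ih =>
    rw [Complex.one_div_Gamma_eq_self_mul_one_div_Gamma_add_one, norm_mul]
    have h := ih (w + 1)
    have e : w + 1 + (N : ℂ) = w + ((N + 1 : ℕ) : ℂ) := by push_cast; ring
    rw [e] at h
    have h1 : ‖w + 1‖ + N ≤ ‖w‖ + ((N + 1 : ℕ) : ℝ) := by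
      have := norm_add_le w 1
      rw [norm_one] at this
      push_cast
      linarith
    have h2 : ‖w‖ ≤ ‖w‖ + ((N + 1 : ℕ) : ℝ) := by
      have : (0 : ℝ) ≤ ((N + 1 : ℕ) : ℝ) := by positivity
      linarith
    calc ‖w‖ * ‖(Complex.Gamma (w + 1))⁻¹‖
        ≤ (‖w‖ + ((N + 1 : ℕ) : ℝ)) * ((‖w‖ + ((N + 1 : ℕ) : ℝ)) ^ N
            * ‖(Complex.Gamma (w + ((N + 1 : ℕ) : ℂ)))⁻¹‖) := by
          refine mul_le_mul h2 (h.trans ?_) (norm_nonneg _) (by positivity)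
          gcongr
      _ = _ := by ring

/-- On Re w = 1/2 the reflection formula pairs w with its conjugate, so |Γ(1/2+iv)|² = π/cosh(πv).
This is the source of the rate π/2. -/
lemma Complex.norm_inv_Gamma_half_le (v : ℝ) :
    ‖(Complex.Gamma (1 / 2 + v * Complex.I))⁻¹‖ ≤ Real.exp (Real.pi / 2 * |v|) := by
  have h := Complex.Gamma_mul_Gamma_one_sub (1 / 2 + v * Complex.I)
  have hconj : (1 : ℂ) - (1 / 2 + v * Complex.I)
      = (starRingEnd ℂ) (1 / 2 + v * Complex.I) := by
    simp only [map_add, map_mul, Complex.conj_I, Complex.conj_ofReal, map_div₀, map_one,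
      map_ofNat]
    ring
  have hsin : Complex.sin (Real.pi * (1 / 2 + v * Complex.I)) = Real.cosh (Real.pi * v) := by
    have : (Real.pi : ℂ) * (1 / 2 + v * Complex.I)
        = (Real.pi * v : ℂ) * Complex.I + Real.pi / 2 := by ring
    rw [this, Complex.sin_add_pi_div_two, Complex.cos_mul_I]
    push_cast
    rfl
  rw [hconj, Complex.Gamma_conj, Complex.mul_conj, hsin] at h
  norm_cast at h
  rw [Complex.normSq_eq_norm_sq] at h
  have hcosh : Real.cosh (Real.pi * v) ≤ Real.exp (Real.pi * |v|) := by
    rw [← Real.cosh_abs, abs_mul, abs_of_pos Real.pi_pos, Real.cosh_eq]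
    have : Real.exp (-(Real.pi * |v|)) ≤ Real.exp (Real.pi * |v|) := by
      apply Real.exp_le_exp.2
      have : 0 ≤ Real.pi * |v| := by positivity
      linarith
    linarith
  rw [norm_inv]
  refine abs_le_of_sq_le_sq' ?_ (Real.exp_pos _).le |>.2
  rw [inv_pow]
  rw [h, inv_div, ← Real.exp_nat_mul]
  have h3 : Real.exp ((2 : ℕ) * (Real.pi / 2 * |v|)) = Real.exp (Real.pi * |v|) := by
    congr 1; push_cast; ring
  rw [h3, div_le_iff₀ Real.pi_pos]
  have := Real.pi_gt_three
  have h4 := Real.exp_pos (Real.pi * |v|)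
  nlinarith

lemma exists_bound_norm_inv_Gamma (a b : ℝ) :
    ∃ C : ℝ, 0 ≤ C ∧ ∀ x ∈ Set.Icc a b, ‖(Complex.Gamma (x : ℂ))⁻¹‖ ≤ C := by
  have hc : ContinuousOn (fun x : ℝ => (Complex.Gamma (x : ℂ))⁻¹) (Set.Icc a b) :=
    (Complex.differentiable_one_div_Gamma.continuous.comp Complex.continuous_ofReal).continuousOn
  obtain ⟨C, hC⟩ := isCompact_Icc.exists_bound_of_continuousOn hc
  exact ⟨max C 0, le_max_right _ _, fun x hx => (hC x hx).trans (le_max_left _ _)⟩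

lemma exists_bound_norm_Gamma (a b : ℝ) (ha : 0 < a) :
    ∃ C : ℝ, 0 ≤ C ∧ ∀ x ∈ Set.Icc a b, ‖Complex.Gamma (x : ℂ)‖ ≤ C := by
  have hc : ContinuousOn (fun x : ℝ => Complex.Gamma (x : ℂ)) (Set.Icc a b) := by
    intro x hx
    refine ContinuousAt.continuousWithinAt ?_
    refine ContinuousAt.comp (g := Complex.Gamma) (Complex.differentiableAt_Gamma _ ?_).continuousAt
      Complex.continuous_ofReal.continuousAt
    intro m h
    have h' : x = -(m : ℝ) := by exact_mod_cast h
    have : (0 : ℝ) ≤ m := by positivity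
    linarith [hx.1]
  obtain ⟨C, hC⟩ := isCompact_Icc.exists_bound_of_continuousOn hc
  exact ⟨max C 0, le_max_right _ _, fun x hx => (hC x hx).trans (le_max_left _ _)⟩

lemma norm_affine_add_nat_le (c α : ℝ) (hα : 0 ≤ α) (N : ℕ) (z : ℂ) :
    ‖(c + α * z : ℂ)‖ + N ≤ (|c| + N) + α * ‖z‖ := by
  have h := norm_add_le (c : ℂ) (α * z)
  rw [norm_mul, Complex.norm_real, Complex.norm_real, Real.norm_eq_abs,
    Real.norm_of_nonneg hα] at h
  linarith

lemma hasExpTypeOnStrip_inv_Gamma (a b c α : ℝ) (hα : 0 < α) :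
    HasExpTypeOnStrip a b (Real.pi / 2 * α) (fun z => (Complex.Gamma (c + α * z))⁻¹) := by
  obtain ⟨N, hN⟩ := exists_nat_ge (1 - c - α * a)
  obtain ⟨C, hC0, hC⟩ := exists_bound_norm_inv_Gamma (c + α * a + N) (c + α * b + N)
  have hexp : HasExpTypeOnStrip a b (Real.pi / 2 * α)
      (fun z => ((Real.exp (Real.pi / 2 * α * |z.im|) : ℝ) : ℂ)) := by
    intro ε hε
    refine ⟨1, fun z _ => ?_⟩
    rw [Complex.norm_real, Real.norm_of_nonneg (Real.exp_pos _).le, one_mul]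
    apply Real.exp_le_exp.2
    have := abs_nonneg z.im
    nlinarith
  have hmul := (hasExpTypeOnStrip_affine_pow a b (|c| + N) α (by positivity) hα.le N).mul hexp
  rw [zero_add] at hmul
  refine hmul.of_norm_le (‖Complex.Gamma ((1 / 2 : ℝ) : ℂ)‖ * C) (by positivity) fun z hz => ?_
  have h1 := Complex.norm_inv_Gamma_le_shift N (c + α * z)
  have hge : 1 ≤ c + α * z.re + N := by nlinarith [hz.1]
  have h2 := Complex.norm_Gamma_mul_norm_inv_Gamma_add_le (1 / 2 + (α * z.im : ℝ) * Complex.I)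
    (c + α * z.re + N - 1 / 2) (by simp) (by linarith)
  have e1 : (1 / 2 + (α * z.im : ℝ) * Complex.I + (c + α * z.re + N - 1 / 2 : ℝ) : ℂ)
      = c + α * z + N := by
    conv_rhs => rw [← Complex.re_add_im z]
    push_cast
    ring
  have e2 : (1 / 2 + (α * z.im : ℝ) * Complex.I : ℂ).re = 1 / 2 := by simp
  have e3 : (((1 / 2 : ℝ) : ℂ) + (c + α * z.re + N - 1 / 2 : ℝ)) = ((c + α * z.re + N : ℝ) : ℂ) := by
    push_cast; ring
  rw [e1, e2, e3] at h2
  have h3 := hC (c + α * z.re + N) ⟨by nlinarith [hz.1], by nlinarith [hz.2]⟩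
  have h4 := Complex.norm_inv_Gamma_half_le (α * z.im)
  rw [abs_mul, abs_of_pos hα, ← mul_assoc] at h4
  have hne : Complex.Gamma (1 / 2 + (α * z.im : ℝ) * Complex.I) ≠ 0 :=
    Complex.Gamma_ne_zero_of_re_pos (by simp)
  have h5 : ‖(Complex.Gamma (c + α * z + N))⁻¹‖ ≤
      (‖Complex.Gamma ((1 / 2 : ℝ) : ℂ)‖ * C) * Real.exp (Real.pi / 2 * α * |z.im|) := by
    calc ‖(Complex.Gamma (c + α * z + N))⁻¹‖
        = (‖Complex.Gamma (1 / 2 + (α * z.im : ℝ) * Complex.I)‖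
            * ‖(Complex.Gamma (c + α * z + N))⁻¹‖)
            * ‖(Complex.Gamma (1 / 2 + (α * z.im : ℝ) * Complex.I))⁻¹‖ := by
          rw [norm_inv (Complex.Gamma (1 / 2 + _))]
          rw [mul_right_comm, mul_inv_cancel₀ (norm_ne_zero_iff.2 hne), one_mul]
      _ ≤ _ := by
          refine mul_le_mul (h2.trans ?_) h4 (norm_nonneg _) (by positivity)
          gcongr
  have h6 := norm_affine_add_nat_le c α hα.le N z
  rw [norm_mul, Complex.norm_real, Complex.norm_real, Real.norm_of_nonneg (by positivity),
    Real.norm_of_nonneg (Real.exp_pos _).le]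
  calc ‖(Complex.Gamma (c + α * z))⁻¹‖
      ≤ ((|c| + N) + α * ‖z‖) ^ N * ((‖Complex.Gamma ((1 / 2 : ℝ) : ℂ)‖ * C)
          * Real.exp (Real.pi / 2 * α * |z.im|)) := by
        refine h1.trans (mul_le_mul ?_ h5 (norm_nonneg _) (by positivity))
        exact pow_le_pow_left₀ (by positivity) h6 N
    _ = _ := by ring

/-- Conjugating z in the denominator keeps its modulus and gives both arguments the same imaginary
part. They then differ by a real number, and the Beta comparison cancels the exponential factors. -/
lemma hasExpTypeOnStrip_Gamma_div_Gamma (a b c c' β : ℝ) (hβ : 0 < β) (hc : 0 < c + β * a) :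
    HasExpTypeOnStrip a b 0
      (fun z => Complex.Gamma (c + β * z) * (Complex.Gamma (c' - β * z))⁻¹) := by
  -- This makes the real difference c' - c - 2β Re z + N at least 1 on the strip.
  obtain ⟨N, hN⟩ := exists_nat_ge (1 - c' + c + 2 * β * b)
  obtain ⟨C, hC0, hC⟩ := exists_bound_norm_inv_Gamma (c' - β * b + N) (c' - β * a + N)
  obtain ⟨D, hD0, hD⟩ := exists_bound_norm_Gamma (c + β * a) (c + β * b) hc
  refine (hasExpTypeOnStrip_affine_pow a b (|-c'| + N) β (by positivity) hβ.le N).of_norm_le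
    (D * C) (by positivity) fun z hz => ?_
  have hconj : ‖(Complex.Gamma (c' - β * z))⁻¹‖
      = ‖(Complex.Gamma (c' - β * (starRingEnd ℂ) z))⁻¹‖ := by
    have : (c' - β * (starRingEnd ℂ) z : ℂ) = (starRingEnd ℂ) (c' - β * z) := by simp
    rw [this, Complex.Gamma_conj, norm_inv, norm_inv, RCLike.norm_conj]
  have h1 := Complex.norm_inv_Gamma_le_shift N (c' - β * (starRingEnd ℂ) z)
  have hre : (c + β * z : ℂ).re = c + β * z.re := by simp
  have h2 := Complex.norm_Gamma_mul_norm_inv_Gamma_add_le (c + β * z)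
    (c' - c - 2 * β * z.re + N) (by rw [hre]; nlinarith [hz.1]) (by nlinarith [hz.2])
  have e1 : (c + β * z + (c' - c - 2 * β * z.re + N : ℝ) : ℂ)
      = c' - β * (starRingEnd ℂ) z + N := by
    apply Complex.ext
    · simp; ring
    · simp
  have e3 : ((c + β * z.re : ℝ) : ℂ) + (c' - c - 2 * β * z.re + N : ℝ)
      = ((c' - β * z.re + N : ℝ) : ℂ) := by
    push_cast; ring
  rw [e1, hre, e3] at h2
  have h3 := hC (c' - β * z.re + N) ⟨by nlinarith [hz.2], by nlinarith [hz.1]⟩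
  have h4 := hD (c + β * z.re) ⟨by nlinarith [hz.1], by nlinarith [hz.2]⟩
  have h6 := norm_affine_add_nat_le (-c') β hβ.le N ((starRingEnd ℂ) z)
  have e4 : ‖(((-c' : ℝ) : ℂ) + β * (starRingEnd ℂ) z)‖ = ‖(c' - β * (starRingEnd ℂ) z : ℂ)‖ := by
    rw [← norm_neg]; congr 1; push_cast; ring
  rw [e4, RCLike.norm_conj] at h6
  rw [norm_mul, hconj, Complex.norm_real, Real.norm_of_nonneg (by positivity)]
  calc ‖Complex.Gamma (c + β * z)‖ * ‖(Complex.Gamma (c' - β * (starRingEnd ℂ) z))⁻¹‖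
      ≤ ‖Complex.Gamma (c + β * z)‖ * ((|-c'| + N + β * ‖z‖) ^ N *
          ‖(Complex.Gamma (c' - β * (starRingEnd ℂ) z + N))⁻¹‖) := by
        refine mul_le_mul_of_nonneg_left (h1.trans ?_) (norm_nonneg _)
        gcongr
    _ = (‖Complex.Gamma (c + β * z)‖ * ‖(Complex.Gamma (c' - β * (starRingEnd ℂ) z + N))⁻¹‖)
          * (|-c'| + N + β * ‖z‖) ^ N := by ring
    _ ≤ (D * C) * (|-c'| + N + β * ‖z‖) ^ N := by
        refine mul_le_mul_of_nonneg_right (h2.trans ?_) (by positivity)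
        gcongr

/-- By reflection the product is -π/sin(πz). The real part of the sine is sin(π Re z) cosh(π Im z),
and sin(π Re z) stays away from 0 because [a,b] lies inside (-1,0). -/
lemma hasExpTypeOnStrip_Gamma_mul_Gamma (a b : ℝ) (ha : -1 < a) (hb : b < 0) :
    HasExpTypeOnStrip a b (-Real.pi) (fun z => Complex.Gamma (1 + z) * Complex.Gamma (-z)) := by
  have hc : ContinuousOn (fun x : ℝ => (Real.sin (Real.pi * x))⁻¹) (Set.Icc a b) := by
    refine ContinuousOn.inv₀ (by fun_prop) fun x hx => ?_
    have hpi := Real.pi_pos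
    refine (Real.sin_neg_of_neg_of_neg_pi_lt ?_ ?_).ne
    · nlinarith [hx.2]
    · nlinarith [hx.1]
  obtain ⟨M, hM⟩ := isCompact_Icc.exists_bound_of_continuousOn hc
  intro ε hε
  refine ⟨Real.pi * (M * 2), fun z hz => ?_⟩
  have h1 := Complex.Gamma_mul_Gamma_one_sub (-z)
  have e1 : (1 : ℂ) - -z = 1 + z := by ring
  rw [e1] at h1
  beta_reduce
  rw [mul_comm (Complex.Gamma (1 + z)), h1, norm_div, Complex.norm_real, Real.norm_of_nonneg Real.pi_pos.le,
    mul_neg, Complex.sin_neg, norm_neg]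
  have hM' := hM z.re hz
  rw [norm_inv, Real.norm_eq_abs] at hM'
  have h2 : |Real.sin (Real.pi * z.re)| * Real.cosh (Real.pi * z.im)
      ≤ ‖Complex.sin (Real.pi * z)‖ := by
    have h3 := Complex.abs_re_le_norm (Complex.sin (Real.pi * z))
    have h4 : (Complex.sin (Real.pi * z)).re
        = Real.sin (Real.pi * z.re) * Real.cosh (Real.pi * z.im) := by
      have e2 : (Real.pi * z : ℂ).re = Real.pi * z.re := by simp
      have e3 : (Real.pi * z : ℂ).im = Real.pi * z.im := by simp
      rw [Complex.sin_eq, e2, e3, ← Complex.ofReal_sin, ← Complex.ofReal_cosh,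
        ← Complex.ofReal_cos, ← Complex.ofReal_sinh, ← Complex.ofReal_mul, ← Complex.ofReal_mul,
        Complex.add_re, Complex.mul_I_re, Complex.ofReal_im, Complex.ofReal_re, neg_zero, add_zero]
    rw [h4, abs_mul, abs_of_pos (Real.cosh_pos _)] at h3
    exact h3
  have hs : 0 < |Real.sin (Real.pi * z.re)| := by
    have hpi := Real.pi_pos
    refine abs_pos.2 (Real.sin_neg_of_neg_of_neg_pi_lt ?_ ?_).ne
    · nlinarith [hz.2]
    · nlinarith [hz.1]
  have h5 : Real.exp (Real.pi * |z.im|) / 2 ≤ Real.cosh (Real.pi * z.im) := by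
    rw [← Real.cosh_abs, abs_mul, abs_of_pos Real.pi_pos, Real.cosh_eq]
    linarith [Real.exp_pos (-(Real.pi * |z.im|))]
  have h6 : (Real.cosh (Real.pi * z.im))⁻¹ ≤ 2 * Real.exp ((-Real.pi + ε) * |z.im|) := by
    have h7 : (Real.cosh (Real.pi * z.im))⁻¹ ≤ (Real.exp (Real.pi * |z.im|) / 2)⁻¹ :=
      inv_anti₀ (by positivity) h5
    refine h7.trans ?_
    rw [inv_div, div_eq_mul_inv, ← Real.exp_neg]
    gcongr
    have := abs_nonneg z.im
    nlinarith
  calc Real.pi / ‖Complex.sin (Real.pi * z)‖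
      ≤ Real.pi / (|Real.sin (Real.pi * z.re)| * Real.cosh (Real.pi * z.im)) := by
        have := Real.cosh_pos (Real.pi * z.im)
        have := Real.pi_pos
        gcongr
    _ = Real.pi * (|Real.sin (Real.pi * z.re)|⁻¹ * (Real.cosh (Real.pi * z.im))⁻¹) := by
        rw [div_eq_mul_inv, mul_inv]
    _ ≤ Real.pi * (M * (2 * Real.exp ((-Real.pi + ε) * |z.im|))) := by
        have := Real.pi_pos
        have := Real.cosh_pos (Real.pi * z.im)
        have hM0 : 0 ≤ M := (by positivity : (0 : ℝ) ≤ |Real.sin (Real.pi * z.re)|⁻¹).trans hM'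
        gcongr
    _ = _ := by ring

/-! ### Integrals over vertical lines. -/

lemma integrable_exp_neg_mul_abs (δ : ℝ) (hδ : 0 < δ) :
    MeasureTheory.Integrable (fun y : ℝ => Real.exp (-δ * |y|)) := by
  rw [← MeasureTheory.integrableOn_univ, ← Set.Iic_union_Ioi (a := (0 : ℝ))]
  refine MeasureTheory.IntegrableOn.union ?_ ?_
  · refine (integrableOn_exp_mul_Iic hδ 0).congr_fun (fun y hy => ?_) measurableSet_Iic
    simp only [abs_of_nonpos (Set.mem_Iic.1 hy), neg_mul_neg]
  · refine (integrableOn_exp_mul_Ioi (neg_lt_zero.2 hδ) 0).congr_fun (fun y hy => ?_)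
      measurableSet_Ioi
    simp only [abs_of_pos (Set.mem_Ioi.1 hy)]

lemma integrable_vertical_of_exp_decay {f : ℂ → ℂ} {x C δ : ℝ} (hδ : 0 < δ)
    (hf : ∀ z : ℂ, z.re = x → DifferentiableAt ℂ f z)
    (hb : ∀ z : ℂ, z.re = x → ‖f z‖ ≤ C * Real.exp (-δ * |z.im|)) :
    MeasureTheory.Integrable (fun y : ℝ => f (x + y * Complex.I)) := by
  refine ((integrable_exp_neg_mul_abs δ hδ).const_mul C).mono' ?_ ?_
  · refine Continuous.aestronglyMeasurable (continuous_iff_continuousAt.2 fun y => ?_)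
    refine ContinuousAt.comp (g := f) (hf _ (by simp)).continuousAt ?_
    fun_prop
  · refine Filter.Eventually.of_forall fun y => ?_
    simpa using hb (x + y * Complex.I) (by simp)

/-- Shifting a vertical contour inside a strip where the integrand is holomorphic and decays
exponentially. -/
lemma integral_vertical_eq_of_exp_decay {f : ℂ → ℂ} {a b C δ : ℝ} (hab : a ≤ b) (hδ : 0 < δ)
    (hf : ∀ z : ℂ, z.re ∈ Set.Icc a b → DifferentiableAt ℂ f z)
    (hb : ∀ z : ℂ, z.re ∈ Set.Icc a b → ‖f z‖ ≤ C * Real.exp (-δ * |z.im|)) :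
    ∫ y : ℝ, f (a + y * Complex.I) = ∫ y : ℝ, f (b + y * Complex.I) := by
  have hmem : ∀ x ∈ Set.Icc a b, ∀ z : ℂ, z.re = x → z.re ∈ Set.Icc a b :=
    fun x hx z hz => hz ▸ hx
  have ia : MeasureTheory.Integrable (fun y : ℝ => f (a + y * Complex.I)) :=
    integrable_vertical_of_exp_decay hδ (fun z hz => hf z (hmem a ⟨le_rfl, hab⟩ z hz))
      (fun z hz => hb z (hmem a ⟨le_rfl, hab⟩ z hz))
  have ib : MeasureTheory.Integrable (fun y : ℝ => f (b + y * Complex.I)) :=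
    integrable_vertical_of_exp_decay hδ (fun z hz => hf z (hmem b ⟨hab, le_rfl⟩ z hz))
      (fun z hz => hb z (hmem b ⟨hab, le_rfl⟩ z hz))
  have ta := MeasureTheory.intervalIntegral_tendsto_integral ia Filter.tendsto_neg_atTop_atBot
    Filter.tendsto_id
  have tb := MeasureTheory.intervalIntegral_tendsto_integral ib Filter.tendsto_neg_atTop_atBot
    Filter.tendsto_id
  have hexp : Filter.Tendsto (fun T : ℝ => C * Real.exp (-δ * T) * |b - a|) Filter.atTop
      (nhds 0) := by
    have h1 : Filter.Tendsto (fun T : ℝ => Real.exp (-δ * T)) Filter.atTop (nhds 0) :=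
      Real.tendsto_exp_atBot.comp
        (Filter.tendsto_id.const_mul_atTop_of_neg (neg_lt_zero.2 hδ))
    simpa using (h1.const_mul C).mul_const |b - a|
  -- The horizontal edges at heights ±T vanish in the limit.
  have hor : ∀ s : ℝ, s = 1 ∨ s = -1 → Filter.Tendsto
      (fun T : ℝ => ∫ x in a..b, f (x + (s * T : ℝ) * Complex.I)) Filter.atTop (nhds 0) := by
    intro s hs
    refine squeeze_zero_norm' ?_ hexp
    filter_upwards [Filter.eventually_ge_atTop 0] with T hT
    refine intervalIntegral.norm_integral_le_of_norm_le_const fun x hx => ?_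
    rw [Set.uIoc_of_le hab] at hx
    have h2 := hb (x + (s * T : ℝ) * Complex.I) (by simpa using ⟨hx.1.le, hx.2⟩)
    have h3 : |((x : ℂ) + (s * T : ℝ) * Complex.I).im| = T := by
      rcases hs with rfl | rfl <;> simp [abs_of_nonneg hT]
    rwa [h3] at h2
  have t1 := hor 1 (Or.inl rfl)
  have t2 := hor (-1) (Or.inr rfl)
  have hrect : ∀ T : ℝ, (∫ x in a..b, f (x + (-1 * T : ℝ) * Complex.I))
      - (∫ x in a..b, f (x + (1 * T : ℝ) * Complex.I))
      + Complex.I • (∫ y in (-T)..T, f (b + y * Complex.I))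
      - Complex.I • (∫ y in (-T)..T, f (a + y * Complex.I)) = 0 := by
    intro T
    have h := Complex.integral_boundary_rect_eq_zero_of_differentiableOn f
      (⟨a, -T⟩ : ℂ) (⟨b, T⟩ : ℂ) (fun z hz => by
        have h1 := hz.1
        simp only [Set.mem_preimage, Set.uIcc_of_le hab] at h1
        exact (hf z h1).differentiableWithinAt)
    simpa using h
  have tlim := ((t2.sub t1).add (tb.const_smul Complex.I)).sub (ta.const_smul Complex.I)
  have h0 := tendsto_nhds_unique (tlim.congr hrect) tendsto_const_nhds
  have h1 : Complex.I * ((∫ y : ℝ, f (b + y * Complex.I)) - ∫ y : ℝ, f (a + y * Complex.I)) = 0 := by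
    simp only [smul_eq_mul] at h0
    linear_combination h0
  rcases mul_eq_zero.1 h1 with h2 | h2
  · exact absurd h2 Complex.I_ne_zero
  · exact (sub_eq_zero.1 h2).symm

/-! ### Decay of the Barnes kernel and independence of the contour. -/

lemma barnesKernel_eq (d : ℕ) (α β σ γ : ℝ) (z : ℂ) :
    barnesKernel d α β σ γ z =
      (Complex.Gamma (((d : ℝ) / 2 + γ : ℝ) + β * z) *
        (Complex.Gamma (((-γ : ℝ) : ℂ) - β * z))⁻¹) *
      (Complex.Gamma (1 + z) * Complex.Gamma (-z)) *
      (Complex.Gamma (((1 - σ : ℝ) : ℂ) + α * z))⁻¹ := by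
  rw [barnesKernel, div_eq_mul_inv, mul_inv]
  push_cast
  ring

lemma strip_pos (d : ℕ) {β γ x : ℝ} (hβ : 0 < β)
    (hx : max (-1) (-(γ / β) - (d : ℝ) / (2 * β)) < x) :
    -1 < x ∧ 0 < (d : ℝ) / 2 + γ + β * x := by
  obtain ⟨h1, h2⟩ := max_lt_iff.1 hx
  refine ⟨h1, ?_⟩
  have h3 : β * (-(γ / β) - (d : ℝ) / (2 * β)) < β * x := mul_lt_mul_of_pos_left h2 hβ
  have h4 : β * (-(γ / β) - (d : ℝ) / (2 * β)) = -γ - d / 2 := by field_simp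
  linarith

lemma exists_barnesKernel_decay (d : ℕ) {α β : ℝ} (σ γ : ℝ) {a b : ℝ} (hα : 0 < α) (hα2 : α < 2)
    (hβ : 0 < β) (ha : max (-1) (-(γ / β) - (d : ℝ) / (2 * β)) < a) (hb : b < 0) :
    ∃ C δ : ℝ, 0 < δ ∧ ∀ z : ℂ, z.re ∈ Set.Icc a b →
      ‖barnesKernel d α β σ γ z‖ ≤ C * Real.exp (-δ * |z.im|) := by
  obtain ⟨ha1, ha2⟩ := strip_pos d hβ ha
  have h := ((hasExpTypeOnStrip_Gamma_div_Gamma a b ((d : ℝ) / 2 + γ) (-γ) β hβ ha2).mul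
    (hasExpTypeOnStrip_Gamma_mul_Gamma a b ha1 hb)).mul
    (hasExpTypeOnStrip_inv_Gamma a b (1 - σ) α hα)
  -- The total type is -(π/2)(2-α); half of it is given up as ε and the other half remains as the
  -- decay rate.
  have hδ : 0 < Real.pi / 2 * (2 - α) / 2 := by
    have := Real.pi_pos
    have : 0 < 2 - α := by linarith
    positivity
  obtain ⟨C, hC⟩ := h _ hδ
  refine ⟨C, _, hδ, fun z hz => ?_⟩
  rw [barnesKernel_eq]
  convert hC z hz using 3
  ring

lemma differentiableAt_barnesKernel (d : ℕ) (α : ℝ) {β : ℝ} (σ γ : ℝ) {z : ℂ} (hβ : 0 < β)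
    (hz : max (-1) (-(γ / β) - (d : ℝ) / (2 * β)) < z.re) (hz0 : z.re < 0) :
    DifferentiableAt ℂ (barnesKernel d α β σ γ) z := by
  obtain ⟨h1, h2⟩ := strip_pos d hβ hz
  have hG : ∀ w : ℂ, 0 < w.re → DifferentiableAt ℂ Complex.Gamma w := by
    intro w hw
    refine Complex.differentiableAt_Gamma _ fun m hm => ?_
    rw [hm] at hw
    have : (0 : ℝ) ≤ m := by positivity
    simp at hw
    linarith
  have e : barnesKernel d α β σ γ = fun z => (Complex.Gamma (((d : ℝ) / 2 + γ : ℝ) + β * z) *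
        (Complex.Gamma (((-γ : ℝ) : ℂ) - β * z))⁻¹) *
      (Complex.Gamma (1 + z) * Complex.Gamma (-z)) *
      (Complex.Gamma (((1 - σ : ℝ) : ℂ) + α * z))⁻¹ := funext (barnesKernel_eq d α β σ γ)
  have hinv := Complex.differentiable_one_div_Gamma
  rw [e]
  refine ((DifferentiableAt.mul ?_ ?_).mul (DifferentiableAt.mul ?_ ?_)).mul ?_
  · refine DifferentiableAt.comp (g := Complex.Gamma) z (hG _ ?_) (by fun_prop)
    simpa using h2
  · exact DifferentiableAt.comp (g := fun s => (Complex.Gamma s)⁻¹) z (hinv _) (by fun_prop)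
  · refine DifferentiableAt.comp (g := Complex.Gamma) z (hG _ ?_) (by fun_prop)
    simp
    linarith
  · refine DifferentiableAt.comp (g := Complex.Gamma) z (hG _ ?_) (by fun_prop)
    simpa using hz0
  · exact DifferentiableAt.comp (g := fun s => (Complex.Gamma s)⁻¹) z (hinv _) (by fun_prop)

lemma verticalIntegrable_barnesKernel (d : ℕ) {α β : ℝ} (σ γ : ℝ) {ℓ : ℝ} (hα : 0 < α) (hα2 : α < 2)
    (hβ : 0 < β) (hℓ : max (-1) (-(γ / β) - (d : ℝ) / (2 * β)) < ℓ) (hℓ0 : ℓ < 0) :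
    MeasureTheory.Integrable (fun y : ℝ => barnesKernel d α β σ γ (ℓ + y * Complex.I)) := by
  obtain ⟨C, δ, hδ, hC⟩ := exists_barnesKernel_decay d σ γ hα hα2 hβ hℓ hℓ0
  exact integrable_vertical_of_exp_decay hδ
    (fun z hz => differentiableAt_barnesKernel d α σ γ hβ (hz.symm ▸ hℓ) (hz.symm ▸ hℓ0))
    (fun z hz => hC z (hz ▸ ⟨le_rfl, le_rfl⟩))

lemma foxH_eq_of_le (d : ℕ) {α β : ℝ} (σ γ : ℝ) {a b r : ℝ} (hα : 0 < α) (hα2 : α < 2)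
    (hβ : 0 < β) (ha : max (-1) (-(γ / β) - (d : ℝ) / (2 * β)) < a) (hab : a ≤ b) (hb : b < 0)
    (hr : 0 < r) : foxH d α β γ a σ r = foxH d α β γ b σ r := by
  obtain ⟨C, δ, hδ, hC⟩ := exists_barnesKernel_decay d σ γ hα hα2 hβ ha hb
  have hr0 : (r : ℂ) ≠ 0 := by exact_mod_cast hr.ne'
  -- The modulus of r^(-z) depends on Re z only, hence is bounded on the strip.
  obtain ⟨M, hM⟩ := isCompact_Icc.exists_bound_of_continuousOn (s := Set.Icc a b)
    (f := fun x : ℝ => r ^ (-x))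
    (Continuous.continuousOn (by
      exact (Real.continuous_const_rpow hr.ne').comp continuous_neg))
  have hM0 : 0 ≤ M := (norm_nonneg _).trans (hM a ⟨le_rfl, hab⟩)
  have h := integral_vertical_eq_of_exp_decay
    (f := fun z => (r : ℂ) ^ (-z) * barnesKernel d α β σ γ z) (C := M * C) hab hδ
    (fun z hz => by
      refine DifferentiableAt.mul ?_
        (differentiableAt_barnesKernel d α σ γ hβ (ha.trans_le hz.1) (hz.2.trans_lt hb))
      exact (differentiableAt_id.neg).const_cpow (Or.inl hr0))
    (fun z hz => by
      rw [norm_mul, Complex.norm_cpow_eq_rpow_re_of_pos hr, mul_assoc]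
      have h1 := hM z.re hz
      rw [Real.norm_of_nonneg (by positivity)] at h1
      exact mul_le_mul h1 (hC z hz) (norm_nonneg _) hM0)
  simp only [foxH, mellinInv, smul_eq_mul]
  rw [h]

lemma foxH_eq (d : ℕ) {α β : ℝ} (σ γ : ℝ) {a b r : ℝ} (hα : 0 < α) (hα2 : α < 2)
    (hβ : 0 < β) (ha : max (-1) (-(γ / β) - (d : ℝ) / (2 * β)) < a) (ha0 : a < 0)
    (hb : max (-1) (-(γ / β) - (d : ℝ) / (2 * β)) < b) (hb0 : b < 0)
    (hr : 0 < r) : foxH d α β γ a σ r = foxH d α β γ b σ r := by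
  rcases le_total a b with h | h
  · exact foxH_eq_of_le d σ γ hα hα2 hβ ha h hb0 hr
  · exact (foxH_eq_of_le d σ γ hα hα2 hβ hb h ha0 hr).symm

/-! ### Calculus of superpositions of powers. -/

/-- Differentiation in `t` of a superposition of powers `t ^ ω y` whose exponents have constant
real part. -/
lemma hasDerivAt_integral_cpow {G ω : ℝ → ℂ} {p : ℝ} (hω : Measurable ω) (hp : ∀ y, (ω y).re = p)
    (hG : MeasureTheory.Integrable G) (hωG : MeasureTheory.Integrable (fun y => ω y * G y))
    {t : ℝ} (ht : 0 < t) :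
    HasDerivAt (fun s : ℝ => ∫ y, (s : ℂ) ^ ω y * G y)
      (∫ y, (t : ℂ) ^ (ω y - 1) * (ω y * G y)) t := by
  have hcont : ContinuousOn (fun s : ℝ => s ^ (p - 1)) (Set.Icc (t / 2) (2 * t)) := by
    intro s hs
    exact (Real.continuousAt_rpow_const s _ (Or.inl (by linarith [hs.1]))).continuousWithinAt
  -- Since Re ω is constant, |s^(ω y - 1)| = s^(p-1) does not depend on y, so one constant near t
  -- gives the dominating function.
  obtain ⟨M, hM⟩ := isCompact_Icc.exists_bound_of_continuousOn hcont
  have hmeas : ∀ s : ℝ, ∀ c : ℂ, Measurable (fun y => (s : ℂ) ^ (ω y - c)) := fun s c =>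
    measurable_const.pow (hω.sub measurable_const)
  have hI : MeasureTheory.Integrable (fun y => (t : ℂ) ^ ω y * G y) := by
    refine (hG.norm.const_mul (t ^ p)).mono' ?_ (Filter.Eventually.of_forall fun y => ?_)
    · have := hmeas t 0
      simp only [sub_zero] at this
      exact this.aestronglyMeasurable.mul hG.aestronglyMeasurable
    · rw [norm_mul, Complex.norm_cpow_eq_rpow_re_of_pos ht, hp]
  refine (hasDerivAt_integral_of_dominated_loc_of_deriv_le
    (F := fun (s : ℝ) y => (s : ℂ) ^ ω y * G y)
    (F' := fun (s : ℝ) y => (s : ℂ) ^ (ω y - 1) * (ω y * G y))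
    (bound := fun y => M * ‖ω y * G y‖) (s := Set.Icc (t / 2) (2 * t))
    (Icc_mem_nhds (by linarith) (by linarith)) ?_ hI ?_ ?_ (hωG.norm.const_mul M) ?_).2
  · refine Filter.Eventually.of_forall fun s => ?_
    have := hmeas s 0
    simp only [sub_zero] at this
    exact this.aestronglyMeasurable.mul hG.aestronglyMeasurable
  · exact (hmeas t 1).aestronglyMeasurable.mul hωG.aestronglyMeasurable
  · refine Filter.Eventually.of_forall fun y s hs => ?_
    have hs0 : 0 < s := by linarith [hs.1]
    rw [norm_mul, Complex.norm_cpow_eq_rpow_re_of_pos hs0, Complex.sub_re, hp, Complex.one_re]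
    exact mul_le_mul_of_nonneg_right ((le_abs_self _).trans (hM s hs)) (norm_nonneg _)
  · refine Filter.Eventually.of_forall fun y s hs => ?_
    have hs0 : 0 < s := by linarith [hs.1]
    have h := (((hasDerivAt_id (s : ℂ)).cpow_const (c := ω y)
      (Complex.ofReal_mem_slitPlane.2 hs0)).comp_ofReal).mul_const (G y)
    exact h.congr_deriv (by simp only [id]; ring)

lemma integrableOn_sub_rpow_mul_rpow {a p t : ℝ} (ha : 0 < a) (hp : 0 < p) (ht : 0 < t) :
    MeasureTheory.IntegrableOn (fun s : ℝ => (t - s) ^ (a - 1) * s ^ (p - 1)) (Set.Ioo 0 t) := by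
  have h1 := Complex.betaIntegral_scaled (p : ℂ) (a : ℂ) ht
  have h2 : IntervalIntegrable
      (fun x : ℝ => (x : ℂ) ^ ((p : ℂ) - 1) * ((t : ℂ) - x) ^ ((a : ℂ) - 1))
      MeasureTheory.volume 0 t := by
    -- A non-integrable function has integral `0` by convention, which would force B(p,a) = 0,
    -- against Γ(p)Γ(a) ≠ 0.
    by_contra hcon
    rw [intervalIntegral.integral_undef hcon] at h1
    have h3 := Complex.Gamma_mul_Gamma_eq_betaIntegral (s := (p : ℂ)) (t := a) (by simpa using hp)
      (by simpa using ha)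
    have h4 : (t : ℂ) ^ ((p : ℂ) + a - 1) ≠ 0 := by
      rw [Complex.cpow_ne_zero_iff]
      exact Or.inl (by exact_mod_cast ht.ne')
    rw [(mul_eq_zero.1 h1.symm).resolve_left h4, mul_zero] at h3
    exact mul_ne_zero (Complex.Gamma_ne_zero_of_re_pos (by simpa using hp))
      (Complex.Gamma_ne_zero_of_re_pos (by simpa using ha)) h3
  rw [intervalIntegrable_iff_integrableOn_Ioo_of_le ht.le] at h2
  refine MeasureTheory.IntegrableOn.congr_fun h2.norm (fun s hs => ?_) measurableSet_Ioo
  have e : (t : ℂ) - s = ((t - s : ℝ) : ℂ) := by push_cast; rfl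
  rw [norm_mul, e, Complex.norm_cpow_eq_rpow_re_of_pos hs.1,
    Complex.norm_cpow_eq_rpow_re_of_pos (sub_pos.2 hs.2), mul_comm]
  simp

lemma integral_sub_rpow_smul_cpow {a t : ℝ} (ht : 0 < t) (w : ℂ) :
    ∫ s in Set.Ioo 0 t, (t - s) ^ (a - 1) • (s : ℂ) ^ (w - 1)
      = (t : ℂ) ^ (w + a - 1) * Complex.betaIntegral w a := by
  rw [← Complex.betaIntegral_scaled w a ht, intervalIntegral.integral_of_le ht.le,
    MeasureTheory.integral_Ioc_eq_integral_Ioo]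
  refine MeasureTheory.setIntegral_congr_fun measurableSet_Ioo fun s hs => ?_
  rw [Complex.real_smul, Complex.ofReal_cpow (sub_nonneg.2 hs.2.le), mul_comm]
  push_cast
  rfl

/-- The Riemann--Liouville convolution of a superposition of powers `s ^ (w y - 1)` whose
exponents have constant real part larger than `-1`. -/
lemma rl_convolution_integral_cpow {G w : ℝ → ℂ} {a p t : ℝ} (hw : Measurable w)
    (hwp : ∀ y, (w y).re = p) (hp : 0 < p) (ha : 0 < a) (ht : 0 < t)
    (hG : MeasureTheory.Integrable G) :
    MeasureTheory.IntegrableOn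
      (fun s : ℝ => (t - s) ^ (a - 1) • ∫ y, (s : ℂ) ^ (w y - 1) * G y) (Set.Ioo 0 t) ∧
    ∫ s in Set.Ioo 0 t, (t - s) ^ (a - 1) • ∫ y, (s : ℂ) ^ (w y - 1) * G y
      = ∫ y, (t : ℂ) ^ (w y + a - 1) * (Complex.betaIntegral (w y) a * G y) := by
  set μ : MeasureTheory.Measure ℝ := MeasureTheory.volume.restrict (Set.Ioo 0 t) with hμ
  -- Fubini applies because the modulus is the product of (t-s)^(a-1) s^(p-1) and |G(y)|.
  have hF : MeasureTheory.Integrable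
      (Function.uncurry fun (s y : ℝ) => (t - s) ^ (a - 1) • ((s : ℂ) ^ (w y - 1) * G y))
      (μ.prod MeasureTheory.volume) := by
    refine ((integrableOn_sub_rpow_mul_rpow ha hp ht).mul_prod hG.norm).mono' ?_ ?_
    · have m1 : Measurable (fun z : ℝ × ℝ => (t - z.1) ^ (a - 1)) :=
        (measurable_const.sub measurable_fst).pow measurable_const
      have m2 : Measurable (fun z : ℝ × ℝ => (z.1 : ℂ) ^ (w z.2 - 1)) :=
        (Complex.measurable_ofReal.comp measurable_fst).pow
          ((hw.comp measurable_snd).sub measurable_const)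
      exact m1.aestronglyMeasurable.smul
        (m2.aestronglyMeasurable.mul hG.aestronglyMeasurable.comp_snd)
    · have hae : ∀ᵐ s ∂μ, s ∈ Set.Ioo 0 t := MeasureTheory.ae_restrict_mem measurableSet_Ioo
      filter_upwards [(MeasureTheory.Measure.quasiMeasurePreserving_fst
        (ν := (MeasureTheory.volume : MeasureTheory.Measure ℝ))).ae hae] with z hz
      simp only [Function.uncurry]
      have h0 : 0 ≤ t - z.1 := sub_nonneg.2 hz.2.le
      rw [norm_smul, norm_mul, Complex.norm_cpow_eq_rpow_re_of_pos hz.1, Complex.sub_re, hwp,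
        Complex.one_re, Real.norm_of_nonneg (Real.rpow_nonneg h0 _), mul_assoc]
  have hsmul : ∀ s : ℝ, (∫ y, (t - s) ^ (a - 1) • ((s : ℂ) ^ (w y - 1) * G y))
      = (t - s) ^ (a - 1) • ∫ y, (s : ℂ) ^ (w y - 1) * G y := fun s =>
    MeasureTheory.integral_smul _ _
  refine ⟨?_, ?_⟩
  · have := hF.integral_prod_left
    simp only [Function.uncurry, hsmul] at this
    exact this
  · simp only [← hsmul]
    rw [MeasureTheory.integral_integral_swap hF]
    refine MeasureTheory.integral_congr_ae (Filter.Eventually.of_forall fun y => ?_)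
    simp only
    rw [← mul_assoc, ← integral_sub_rpow_smul_cpow ht, ← MeasureTheory.integral_mul_const]
    simp only [smul_mul_assoc]
    rfl

lemma hasDerivAt_family_iterate {u : ℝ → ℝ → ℂ}
    (hu : ∀ σ t : ℝ, 0 < t → HasDerivAt (u σ) (u (σ + 1) t) t) (m : ℕ) (σ : ℝ) :
    ContDiffOn ℝ (m : WithTop ℕ∞) (u σ) (Set.Ioi 0) ∧
      ∀ t : ℝ, 0 < t → iteratedDeriv m (u σ) t = u (σ + m) t := by
  constructor
  · induction m generalizing σ with
    | zero =>
      rw [Nat.cast_zero, contDiffOn_zero]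
      exact fun t ht => (hu σ t ht).continuousAt.continuousWithinAt
    | succ m ih =>
      push_cast
      rw [contDiffOn_succ_iff_deriv_of_isOpen isOpen_Ioi]
      refine ⟨fun t ht => (hu σ t ht).differentiableAt.differentiableWithinAt, by simp, ?_⟩
      exact (ih (σ + 1)).congr fun t ht => (hu σ t ht).deriv
  · induction m with
    | zero => simp
    | succ m ih =>
      intro t ht
      rw [iteratedDeriv_succ]
      -- The formula is known only on (0,∞); equality near t suffices for the next derivative.
      have he : iteratedDeriv m (u σ) =ᶠ[nhds t] u (σ + m) := by
        filter_upwards [Ioi_mem_nhds ht] with s hs using ih s hs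
      rw [he.deriv_eq, (hu _ t ht).deriv]
      push_cast
      rw [add_assoc]

/-! ### The kernel as a superposition of powers of t. -/

/-- The exponent of `t` in the Mellin--Barnes integrand of `kernelP`. -/
noncomputable def barnesExponent (α ℓ σ y : ℝ) : ℂ := α * (ℓ + y * Complex.I) - σ

/-- The factor of the Mellin--Barnes integrand of `kernelP` that does not depend on `t`. -/
noncomputable def barnesDensity (d : ℕ) (α β γ ℓ ρ σ y : ℝ) : ℂ :=
  (ρ : ℂ) ^ (-(ℓ + y * Complex.I)) * barnesKernel d α β σ γ (ℓ + y * Complex.I)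

lemma measurable_barnesExponent (α ℓ σ : ℝ) : Measurable (barnesExponent α ℓ σ) := by
  unfold barnesExponent
  fun_prop

lemma barnesExponent_re (α ℓ σ y : ℝ) : (barnesExponent α ℓ σ y).re = α * ℓ - σ := by
  simp [barnesExponent]

lemma integrable_barnesDensity (d : ℕ) {α β γ ℓ ρ : ℝ} (σ : ℝ) (hα : 0 < α) (hα2 : α < 2)
    (hβ : 0 < β) (hℓ : max (-1) (-(γ / β) - (d : ℝ) / (2 * β)) < ℓ) (hℓ0 : ℓ < 0) (hρ : 0 < ρ) :
    MeasureTheory.Integrable (barnesDensity d α β γ ℓ ρ σ) := by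
  have hK := verticalIntegrable_barnesKernel d σ γ hα hα2 hβ hℓ hℓ0
  refine (hK.norm.const_mul (ρ ^ (-ℓ))).mono' ?_ (Filter.Eventually.of_forall fun y => ?_)
  · refine AEMeasurable.aestronglyMeasurable (Measurable.aemeasurable ?_) |>.mul
      hK.aestronglyMeasurable
    exact measurable_const.pow (by fun_prop)
  · rw [barnesDensity, norm_mul, Complex.norm_cpow_eq_rpow_re_of_pos hρ]
    simp

/-- This is 1/Γ(w) = w/Γ(w+1) at w = αz - σ, valid also at the poles of Γ. -/
lemma barnesExponent_mul_barnesDensity (d : ℕ) (α β γ ℓ ρ σ y : ℝ) :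
    barnesExponent α ℓ σ y * barnesDensity d α β γ ℓ ρ σ y
      = barnesDensity d α β γ ℓ ρ (σ + 1) y := by
  set z : ℂ := ℓ + y * Complex.I with hz
  have h := Complex.one_div_Gamma_eq_self_mul_one_div_Gamma_add_one (α * z - σ)
  have e1 : (α * z - σ + 1 : ℂ) = 1 - σ + α * z := by ring
  have e2 : (α * z - σ : ℂ) = 1 - ((σ + 1 : ℝ) : ℂ) + α * z := by push_cast; ring
  rw [e1] at h
  rw [barnesDensity, barnesDensity, barnesExponent, ← hz, barnesKernel, barnesKernel, ← e2,
    div_eq_mul_inv (_ * _ * _), div_eq_mul_inv (_ * _ * _), mul_inv, mul_inv, h]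
  ring

/-- With w = αz - η + 1, the factor Γ(w) in B(w,a) = Γ(w)Γ(a)/Γ(w+a) cancels the 1/Γ(w) of the
kernel. The assumption on η says Re w > 0. -/
lemma betaIntegral_mul_barnesDensity (d : ℕ) (α β γ ℓ ρ : ℝ) {η a : ℝ} (y : ℝ) (ha : 0 < a)
    (hη : 0 < α * ℓ - η + 1) :
    Complex.betaIntegral (barnesExponent α ℓ η y + 1) a * barnesDensity d α β γ ℓ ρ η y
      = Complex.Gamma a * barnesDensity d α β γ ℓ ρ (η - a) y := by
  set w : ℂ := barnesExponent α ℓ η y + 1 with hw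
  have hwre : 0 < w.re := by
    rw [hw, Complex.add_re, barnesExponent_re, Complex.one_re]
    exact hη
  have h := Complex.Gamma_mul_Gamma_eq_betaIntegral (s := w) (t := a) hwre (by simpa using ha)
  have hG1 : Complex.Gamma w ≠ 0 := Complex.Gamma_ne_zero_of_re_pos hwre
  have hG2 : Complex.Gamma (w + a) ≠ 0 :=
    Complex.Gamma_ne_zero_of_re_pos (by simpa using add_pos hwre ha)
  set z : ℂ := ℓ + y * Complex.I with hz
  have e1 : 1 - (η : ℂ) + α * z = w := by rw [hw, barnesExponent]; ring
  have e2 : 1 - ((η - a : ℝ) : ℂ) + α * z = w + a := by rw [← e1]; push_cast; ring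
  have hB : Complex.betaIntegral w a = Complex.Gamma w * Complex.Gamma a
      * (Complex.Gamma (w + a))⁻¹ := by
    rw [h, mul_right_comm, mul_inv_cancel₀ hG2, one_mul]
  rw [barnesDensity, barnesDensity, ← hz, barnesKernel, barnesKernel, e1, e2, hB,
    div_eq_mul_inv (_ * _ * _), div_eq_mul_inv (_ * _ * _), mul_inv, mul_inv]
  have hc : Complex.Gamma w * (Complex.Gamma w)⁻¹ = 1 := mul_inv_cancel₀ hG1
  linear_combination (Complex.Gamma a * (Complex.Gamma (w + a))⁻¹ * (ρ : ℂ) ^ (-z)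
    * (Complex.Gamma ((d : ℂ) / 2 + γ + β * z) * Complex.Gamma (1 + z) * Complex.Gamma (-z))
    * (Complex.Gamma (-γ - β * z))⁻¹) * hc

lemma ofReal_rpow_cpow {t : ℝ} (ht : 0 < t) (a : ℝ) (z : ℂ) :
    ((t ^ a : ℝ) : ℂ) ^ z = (t : ℂ) ^ (a * z) := by
  rw [Complex.cpow_def_of_ne_zero (by exact_mod_cast (Real.rpow_pos_of_pos ht a).ne'),
    Complex.cpow_def_of_ne_zero (by exact_mod_cast ht.ne'), ← Complex.ofReal_log ht.le,
    ← Complex.ofReal_log (Real.rpow_nonneg ht.le a), Real.log_rpow ht]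
  push_cast
  ring_nf

/-- The power (ρ t^(-α))^(-z) splits as ρ^(-z) t^(αz), and t^(αz) absorbs the prefactor t^(-σ). -/
lemma kernelP_eq (d : ℕ) (α β γ ℓ σ : ℝ) {t : ℝ} (ht : 0 < t) (x : EuclideanSpace ℝ (Fin d)) :
    kernelP d α β γ ℓ σ t x =
      ((2 ^ (2 * γ) / Real.pi ^ ((d : ℝ) / 2) * ‖x‖ ^ (-(d : ℝ) - 2 * γ) * (1 / (2 * Real.pi)) : ℝ)
        : ℂ) *
      ∫ y, (t : ℂ) ^ barnesExponent α ℓ σ y *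
        barnesDensity d α β γ ℓ (‖x‖ ^ (2 * β) / 2 ^ (2 * β)) σ y := by
  set ρ : ℝ := ‖x‖ ^ (2 * β) / 2 ^ (2 * β) with hρ
  have hρ0 : 0 ≤ ρ := by positivity
  have hint : ∀ y : ℝ, (t : ℂ) ^ barnesExponent α ℓ σ y * barnesDensity d α β γ ℓ ρ σ y
      = ((t ^ (-σ) : ℝ) : ℂ) * (((ρ * t ^ (-α) : ℝ) : ℂ) ^ (-(ℓ + y * Complex.I))
        • barnesKernel d α β σ γ (ℓ + y * Complex.I)) := by
    intro y
    set z : ℂ := ℓ + y * Complex.I with hz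
    have h1 : ((t ^ (-σ) : ℝ) : ℂ) = (t : ℂ) ^ (-(σ : ℂ)) := by
      rw [Complex.ofReal_cpow ht.le]; push_cast; rfl
    have h2 : (t : ℂ) ^ barnesExponent α ℓ σ y
        = (t : ℂ) ^ (-(σ : ℂ)) * (t : ℂ) ^ (((-α : ℝ) : ℂ) * -z) := by
      rw [← Complex.cpow_add _ _ (by exact_mod_cast ht.ne'), barnesExponent, ← hz]
      congr 1
      push_cast
      ring
    rw [Complex.ofReal_mul, Complex.mul_cpow_ofReal_nonneg hρ0 (Real.rpow_nonneg ht.le _),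
      ofReal_rpow_cpow ht, h1, h2, barnesDensity, ← hz, smul_eq_mul]
    ring
  simp only [hint]
  rw [MeasureTheory.integral_const_mul, kernelP, foxH, mellinInv, ← hρ, Complex.real_smul]
  push_cast
  ring

/-! ### Derivatives and fractional integrals of the kernel. -/

lemma hasDerivAt_kernelP (d : ℕ) {α β γ ℓ : ℝ} (σ : ℝ) (hα : 0 < α) (hα2 : α < 2)
    (hβ : 0 < β) (hℓ : max (-1) (-(γ / β) - (d : ℝ) / (2 * β)) < ℓ) (hℓ0 : ℓ < 0)
    {x : EuclideanSpace ℝ (Fin d)} (hx : x ≠ 0) {t : ℝ} (ht : 0 < t) :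
    HasDerivAt (fun s => kernelP d α β γ ℓ σ s x) (kernelP d α β γ ℓ (σ + 1) t x) t := by
  have hx' : 0 < ‖x‖ := norm_pos_iff.2 hx
  have hρ : 0 < ‖x‖ ^ (2 * β) / 2 ^ (2 * β) := by positivity
  have hI := fun σ => integrable_barnesDensity d σ hα hα2 hβ hℓ hℓ0 hρ
  have h := hasDerivAt_integral_cpow (measurable_barnesExponent α ℓ σ)
    (barnesExponent_re α ℓ σ) (hI σ)
    (by simpa only [barnesExponent_mul_barnesDensity] using hI (σ + 1)) ht
  simp only [barnesExponent_mul_barnesDensity] at h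
  have he : ∀ y, barnesExponent α ℓ σ y - 1 = barnesExponent α ℓ (σ + 1) y := fun y => by
    simp only [barnesExponent]; push_cast; ring
  simp only [he] at h
  rw [kernelP_eq d α β γ ℓ (σ + 1) ht x]
  refine (h.const_mul _).congr_of_eventuallyEq ?_
  filter_upwards [Ioi_mem_nhds ht] with s hs using kernelP_eq d α β γ ℓ σ hs x

lemma kernelP_contour_eq (d : ℕ) {α β γ a b : ℝ} (σ : ℝ) (hα : 0 < α) (hα2 : α < 2)
    (hβ : 0 < β) (ha : max (-1) (-(γ / β) - (d : ℝ) / (2 * β)) < a) (ha0 : a < 0)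
    (hb : max (-1) (-(γ / β) - (d : ℝ) / (2 * β)) < b) (hb0 : b < 0)
    {x : EuclideanSpace ℝ (Fin d)} (hx : x ≠ 0) {t : ℝ} (ht : 0 < t) :
    kernelP d α β γ a σ t x = kernelP d α β γ b σ t x := by
  have hx' : 0 < ‖x‖ := norm_pos_iff.2 hx
  rw [kernelP, kernelP, foxH_eq d σ γ hα hα2 hβ ha ha0 hb hb0 (by positivity)]

lemma rlIntegral_kernelP_of_lt (d : ℕ) {α β γ ℓ η a : ℝ} (hα : 0 < α) (hα2 : α < 2)
    (hβ : 0 < β) (hℓ : max (-1) (-(γ / β) - (d : ℝ) / (2 * β)) < ℓ) (hℓ0 : ℓ < 0)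
    (hη : η - 1 < α * ℓ) (ha : 0 < a)
    {x : EuclideanSpace ℝ (Fin d)} (hx : x ≠ 0) {t : ℝ} (ht : 0 < t) :
    IntervalIntegrable (fun s : ℝ => (t - s) ^ (a - 1) • kernelP d α β γ ℓ η s x)
      MeasureTheory.volume 0 t ∧
    rlIntegral a (fun s => kernelP d α β γ ℓ η s x) t = kernelP d α β γ ℓ (η - a) t x := by
  have hx' : 0 < ‖x‖ := norm_pos_iff.2 hx
  have hρ : 0 < ‖x‖ ^ (2 * β) / 2 ^ (2 * β) := by positivity
  have hp : 0 < α * ℓ - η + 1 := by linarith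
  obtain ⟨h1, h2⟩ := rl_convolution_integral_cpow
    (w := fun y => barnesExponent α ℓ η y + 1) (p := α * ℓ - η + 1)
    ((measurable_barnesExponent α ℓ η).add_const 1)
    (fun y => by rw [Complex.add_re, barnesExponent_re, Complex.one_re]) hp ha ht
    (integrable_barnesDensity d η hα hα2 hβ hℓ hℓ0 hρ)
  simp only [betaIntegral_mul_barnesDensity d α β γ ℓ _ _ ha hp, add_sub_cancel_right] at h1 h2
  set A : ℂ := ((2 ^ (2 * γ) / Real.pi ^ ((d : ℝ) / 2) * ‖x‖ ^ (-(d : ℝ) - 2 * γ)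
    * (1 / (2 * Real.pi)) : ℝ) : ℂ) with hA
  have hk : Set.EqOn
      (fun s : ℝ => A * ((t - s) ^ (a - 1) • ∫ y, (s : ℂ) ^ barnesExponent α ℓ η y *
        barnesDensity d α β γ ℓ (‖x‖ ^ (2 * β) / 2 ^ (2 * β)) η y))
      (fun s : ℝ => (t - s) ^ (a - 1) • kernelP d α β γ ℓ η s x) (Set.Ioo 0 t) := by
    intro s hs
    simp only
    rw [kernelP_eq d α β γ ℓ η hs.1 x, mul_smul_comm]
  refine ⟨?_, ?_⟩
  · rw [intervalIntegrable_iff_integrableOn_Ioo_of_le ht.le]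
    exact MeasureTheory.IntegrableOn.congr_fun (h1.const_mul A) hk measurableSet_Ioo
  · rw [rlIntegral, intervalIntegral.integral_of_le ht.le,
      MeasureTheory.integral_Ioc_eq_integral_Ioo,
      ← MeasureTheory.setIntegral_congr_fun measurableSet_Ioo hk,
      MeasureTheory.integral_const_mul, h2, kernelP_eq d α β γ ℓ (η - a) ht x, ← hA]
    have he : ∀ y, barnesExponent α ℓ η y + 1 + a - 1 = barnesExponent α ℓ (η - a) y := fun y => by
      simp only [barnesExponent]; push_cast; ring
    have hG : (Real.Gamma a : ℂ) ≠ 0 := by exact_mod_cast (Real.Gamma_pos_of_pos ha).ne'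
    simp only [he, mul_left_comm _ (Complex.Gamma a)]
    rw [MeasureTheory.integral_const_mul, Complex.Gamma_ofReal, Complex.real_smul,
      mul_left_comm A, ← mul_assoc]
    push_cast
    rw [one_div, inv_mul_cancel₀ hG, one_mul]

lemma rlIntegral_kernelP (d : ℕ) {α β γ ℓ η a : ℝ} (hα : 0 < α) (hα2 : α < 2)
    (hβ : 0 < β) (hℓ : max (-1) (-(γ / β) - (d : ℝ) / (2 * β)) < ℓ) (hℓ0 : ℓ < 0)
    (hη : η < 1) (ha : 0 < a)
    {x : EuclideanSpace ℝ (Fin d)} (hx : x ≠ 0) {t : ℝ} (ht : 0 < t) :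
    IntervalIntegrable (fun s : ℝ => (t - s) ^ (a - 1) • kernelP d α β γ ℓ η s x)
      MeasureTheory.volume 0 t ∧
    rlIntegral a (fun s => kernelP d α β γ ℓ η s x) t = kernelP d α β γ ℓ (η - a) t x := by
  -- The new abscissa b satisfies αb > η - 1, as the convolution needs, and stays in the pole-free
  -- strip because ℓ < b < 0. It exists because η < 1.
  obtain ⟨b, hb, hb0⟩ := exists_between
    (max_lt hℓ0 (div_neg_of_neg_of_pos (sub_neg.2 hη) hα) : max ℓ ((η - 1) / α) < 0)
  obtain ⟨hb1, hb2⟩ := max_lt_iff.1 hb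
  have hbs := hℓ.trans hb1
  obtain ⟨h1, h2⟩ := rlIntegral_kernelP_of_lt d (η := η) (a := a) hα hα2 hβ hbs hb0
    (by rwa [div_lt_iff₀' hα] at hb2) ha hx ht
  have hk : Set.EqOn (fun s : ℝ => (t - s) ^ (a - 1) • kernelP d α β γ b η s x)
      (fun s : ℝ => (t - s) ^ (a - 1) • kernelP d α β γ ℓ η s x) (Set.Ioo 0 t) := fun s hs => by
    simp only
    rw [kernelP_contour_eq d η hα hα2 hβ hbs hb0 hℓ hℓ0 hx hs.1]
  refine ⟨?_, ?_⟩
  · rw [intervalIntegrable_iff_integrableOn_Ioo_of_le ht.le] at h1 ⊢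
    exact h1.congr_fun hk measurableSet_Ioo
  · rw [kernelP_contour_eq d (η - a) hα hα2 hβ hℓ hℓ0 hbs hb0 hx ht, ← h2, rlIntegral, rlIntegral,
      intervalIntegral.integral_of_le ht.le, intervalIntegral.integral_of_le ht.le,
      MeasureTheory.integral_Ioc_eq_integral_Ioo, MeasureTheory.integral_Ioc_eq_integral_Ioo,
      MeasureTheory.setIntegral_congr_fun measurableSet_Ioo hk]

theorem theorem4p3 (d : ℕ) (hd : 1 ≤ d) (α β γ : ℝ) (hα : 0 < α) (hα2 : α < 2) (hβ : 0 < β)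
    (hγ : 0 ≤ γ) (ℓ : ℝ) (hℓ : max (-1) (-(γ / β) - (d : ℝ) / (2 * β)) < ℓ) (hℓ0 : ℓ < 0) :
    (∀ σ : ℝ, Complex.VerticalIntegrable (barnesKernel d α β σ γ) ℓ) ∧
    (∀ (σ : ℝ) (m : ℕ) (x : EuclideanSpace ℝ (Fin d)), x ≠ 0 →
      ContDiffOn ℝ (m : WithTop ℕ∞) (fun s : ℝ => kernelP d α β γ ℓ σ s x) (Set.Ioi 0) ∧
      ∀ t : ℝ, 0 < t →
        iteratedDeriv m (fun s : ℝ => kernelP d α β γ ℓ σ s x) t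
          = kernelP d α β γ ℓ (σ + m) t x) ∧
    (∀ (σ η : ℝ) (x : EuclideanSpace ℝ (Fin d)), η < 1 → x ≠ 0 →
      RLOpDefined σ (fun s : ℝ => kernelP d α β γ ℓ η s x) ∧
      ∀ t : ℝ, 0 < t →
        rlOp σ (fun s : ℝ => kernelP d α β γ ℓ η s x) t
          = kernelP d α β γ ℓ (σ + η) t x) := by

  have hfam := fun (x : EuclideanSpace ℝ (Fin d)) (hx : x ≠ 0) =>
    hasDerivAt_family_iterate (u := fun σ s => kernelP d α β γ ℓ σ s x)
      (fun σ t ht => hasDerivAt_kernelP d σ hα hα2 hβ hℓ hℓ0 hx ht)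
  refine ⟨fun σ => verticalIntegrable_barnesKernel d σ γ hα hα2 hβ hℓ hℓ0,
    fun σ m x hx => hfam x hx m σ, fun σ η x hη hx => ?_⟩
  have hrl := fun (a : ℝ) (ha : 0 < a) (t : ℝ) (ht : 0 < t) =>
    rlIntegral_kernelP d hα hα2 hβ hℓ hℓ0 hη ha hx ht
  -- The order n - σ is positive even for integer σ, because n = ⌊σ⌋ + 1.
  have ha : 0 < ((⌊σ⌋₊ + 1 : ℕ) : ℝ) - σ := by
    have := Nat.lt_floor_add_one σ
    push_cast
    linarith
  refine ⟨⟨fun T hT => ?_, fun hσ t ht => (hrl (-σ) (by linarith) t ht).1, fun _ =>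
    ⟨fun t ht => (hrl _ ha t ht).1, ?_⟩⟩, fun t ht => ?_⟩
  -- At order 1 the weight is identically 1, so convergence is plain integrability.
  · have h := (hrl 1 one_pos T hT).1
    simp only [sub_self, Real.rpow_zero, one_smul] at h
    rwa [intervalIntegrable_iff_integrableOn_Ioo_of_le hT.le] at h
  · exact (hfam x hx _ _).1.congr fun t ht => (hrl _ ha t ht).2
  · rw [rlOp]
    split_ifs with hσ
    · rw [(hrl (-σ) (by linarith) t ht).2]
      congr 1
      ring
    -- Near t the integral is the kernel of index η - (n - σ); n derivatives raise the index to σ +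
    -- η.
    · have he : rlIntegral ((⌊σ⌋₊ + 1 : ℕ) - σ) (fun s => kernelP d α β γ ℓ η s x) =ᶠ[nhds t]
          fun s => kernelP d α β γ ℓ (η - ((⌊σ⌋₊ + 1 : ℕ) - σ)) s x := by
        filter_upwards [Ioi_mem_nhds ht] with s hs using (hrl _ ha s hs).2
      rw [rlDeriv, he.iteratedDeriv_eq, (hfam x hx _ _).2 t ht]
      congr 1
      ring
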